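/- Let $g\ge 1$, $N=g(g+1)/2$, and let $\mathcal H_g$ be the Siegel upper half-space of symmetric complex $g\times g$ matrices with positive definite imaginary part. For $\varepsilon,\delta\in(\mathbb Z/2\mathbb Z)^g$ (viewed as vectors of zeros and ones), $\tau\in\mathcal H_g$ and $z\in\mathbb C^g$ let $$\theta[\varepsilon,\delta](\tau,z)=\sum_{m\in\mathbb Z^g}\exp \pi i\Big[{}^t(m+\tfrac{\varepsilon}{2})\tau(m+\tfrac{\varepsilon}{2})+2\,{}^t(m+\tfrac{\varepsilon}{2})(z+\tfrac{\delta}{2})\Big],$$ and let $\Theta[\varepsilon](\tau)=\theta[\varepsilon,0](2\tau,0)$ be the second order theta constants. Call $[\varepsilon,\delta]$ odd if $\varepsilon\cdot\delta=1$ in $\mathbb Z/2\mathbb Z$. For $g$ odd characteristics define the jacobian determinant $$D([\varepsilon_1,\delta_1],\dots,[\varepsilon_g,\delta_g])(\tau)=\pi^{-g}\det\big(\partial_{z_i}\theta[\varepsilon_k,\delta_k](\tau,0)\big)_{1\le i,k\le g}.$$ Let $\mathcal C_{\varepsilon,\beta}(\tau)\in\mathbb C^N$ be the vector with entries $2\,\partial_{z_i}\theta[\varepsilon,\beta](\tau,0)\,\partial_{z_j}\theta[\varepsilon,\beta](\tau,0)$,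 $i\le j$, listed in the order $11,12,\dots,1g,22,\dots,gg$. For $\varepsilon_0,\dots,\varepsilon_N\in(\mathbb Z/2\mathbb Z)^g$ let $M(\varepsilon_0,\dots,\varepsilon_N)(\tau)$ be the $(N+1)\times(N+1)$ matrix whose $k$-th column, $0\le k\le N$, has the entries $\Theta[\varepsilon_k](\tau)$ and then $\frac{\partial}{\partial\tau_{ij}}\Theta[\varepsilon_k](\tau)$, $i\le j$, in the same order (with $\tau_{ij}=\tau_{ji}$ regarded as one coordinate). Put $\delta_k=\varepsilon_0+\varepsilon_k$. Then for all $\varepsilon_0,\dots,\varepsilon_N\in(\mathbb Z/2\mathbb Z)^g$ and all $\tau\in\mathcal H_g$ $$c\,\Theta[\varepsilon_0](\tau)^{N-1}\det M(\varepsilon_0,\dots,\varepsilon_N)(\tau)=\sum_{\beta_1,\dots,\beta_N\in(\mathbb Z/2\mathbb Z)^g}(-1)^{\varepsilon_1\cdot\beta_1+\dots+\varepsilon_N\cdot\beta_N}\det\big(\mathcal C_{\delta_1,\beta_1}(\tau),\dots,\mathcal C_{\delta_N,\beta_N}(\tau)\big)$$ with the explicit constant $c=2^{(g+1)N+g}(\pi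 i)^N$, which is nonzero and depends only on $g$. Moreover, for all $\varepsilon_0,\dots,\varepsilon_N$ there is a homogeneous polynomial of degree $g+1$ with complex coefficients not depending on $\tau$ whose value at the jacobian determinants $D(\cdots)(\tau)$ of $g$-tuples of odd characteristics is the right-hand side, for every $\tau\in\mathcal H_g$. -/

import Mathlib

open scoped BigOperators

noncomputable section

/-- The Siegel upper half-space: symmetric complex `g × g` matrices with positive definite
imaginary part. -/
def SiegelUpperHalfSpace (g : ℕ) : Set (Matrix (Fin g) (Fin g) ℂ) :=
  {τ | τ.IsSymm ∧ (τ.map Complex.im).PosDef}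

/-- Vectors in `(ℤ/2ℤ)^g`, the (half-)characteristics in genus `g`. -/
abbrev HalfChar (g : ℕ) : Type := Fin g → ZMod 2

/-- The vector `ε / 2 ∈ ℂ^g`, where `ε` is viewed as a vector of zeros and ones. -/
def HalfChar.half {g : ℕ} (ε : HalfChar g) : Fin g → ℂ := fun i => ((ε i).val : ℂ) / 2

/-- The theta function with characteristic `[ε, δ]`. -/
def thetaChar {g : ℕ} (ε δ : HalfChar g) (τ : Matrix (Fin g) (Fin g) ℂ) (z : Fin g → ℂ) : ℂ :=
  ∑' m : Fin g → ℤ,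
    Complex.exp (Real.pi * Complex.I *
      ((fun i => (m i : ℂ) + ε.half i) ⬝ᵥ τ.mulVec (fun i => (m i : ℂ) + ε.half i)
        + 2 * ((fun i => (m i : ℂ) + ε.half i) ⬝ᵥ (z + δ.half))))

/-- The second order theta function `Θ[ε](τ, z) = θ[ε, 0](2τ, 2z)`. -/
def secondTheta {g : ℕ} (ε : HalfChar g) (τ : Matrix (Fin g) (Fin g) ℂ) (z : Fin g → ℂ) : ℂ :=
  thetaChar ε 0 ((2 : ℂ) • τ) ((2 : ℂ) • z)

/-- The second order theta constant `Θ[ε](τ)`. -/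
def secondThetaConst {g : ℕ} (ε : HalfChar g) (τ : Matrix (Fin g) (Fin g) ℂ) : ℂ :=
  secondTheta ε τ 0

/-- The gradient at `z = 0` of the theta function with characteristic `[ε, δ]`. -/
def thetaGrad {g : ℕ} (ε δ : HalfChar g) (τ : Matrix (Fin g) (Fin g) ℂ) : Fin g → ℂ :=
  fun i => deriv (fun t : ℂ => thetaChar ε δ τ (Pi.single i t)) 0

/-- The symmetric matrix along which `∂/∂τ_ij` differentiates: since `τ_ij = τ_ji` is one single
coordinate of a symmetric matrix, it has ones exactly in the places `(i, j)` and `(j, i)`. -/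
def symUnit {g : ℕ} (i j : Fin g) : Matrix (Fin g) (Fin g) ℂ :=
  fun a b => if (a = i ∧ b = j) ∨ (a = j ∧ b = i) then 1 else 0

/-- The partial derivative `∂/∂τ_ij` of a function on symmetric matrices. -/
def tauDeriv {g : ℕ} (i j : Fin g) (F : Matrix (Fin g) (Fin g) ℂ → ℂ)
    (τ : Matrix (Fin g) (Fin g) ℂ) : ℂ :=
  deriv (fun t : ℂ => F (τ + t • symUnit i j)) 0

/-- `N = g (g + 1) / 2` (an exact division). -/
def symDim (g : ℕ) : ℕ := g * (g + 1) / 2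

/-- The pairs `(i, j)` with `i ≤ j`, inside the lexicographically ordered product. -/
def symPairs (g : ℕ) : Finset (Fin g ×ₗ Fin g) :=
  Finset.univ.filter fun p => (ofLex p).1 ≤ (ofLex p).2

theorem card_symPairs (g : ℕ) : (symPairs g).card = symDim g := by
  have h : (symPairs g).card = Fintype.card (Sym2 (Fin g)) := by
    rw [← Finset.card_univ]
    refine Finset.card_bij (fun p _ => s((ofLex p).1, (ofLex p).2)) (by simp) ?_ ?_
    · intro a ha b hb hab
      simp only [symPairs, Finset.mem_filter, Finset.mem_univ, true_and] at ha hb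
      rcases Sym2.eq_iff.1 hab with ⟨h1, h2⟩ | ⟨h1, h2⟩
      · exact ofLex.injective (Prod.ext h1 h2)
      · exact ofLex.injective (Prod.ext (by omega) (by omega))
    · intro z _
      induction z using Sym2.ind with
      | _ x y =>
        rcases le_total x y with hxy | hxy
        · exact ⟨toLex (x, y), by simpa [symPairs] using hxy, by simp⟩
        · exact ⟨toLex (y, x), by simpa [symPairs] using hxy, by simp [Sym2.eq_swap]⟩
  rw [h, Sym2.card, Fintype.card_fin, Nat.choose_two_right, symDim, Nat.add_sub_cancel,
    Nat.mul_comm]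

/-- The enumeration `11, 12, …, 1g, 22, …, gg` of the pairs `(i, j)` with `i ≤ j`. -/
def symPair (g : ℕ) (r : Fin (symDim g)) : Fin g × Fin g :=
  ofLex ((symPairs g).orderEmbOfFin (card_symPairs g) r)

/-- The matrix `M(ε_0, …, ε_N)(τ)`: the first row consists of the theta constants `Θ[ε_k]`, the
others of their derivatives `∂Θ[ε_k]/∂τ_ij`, `i ≤ j`. -/
def thetaMatrix {g : ℕ} (ε : Fin (symDim g + 1) → HalfChar g) (τ : Matrix (Fin g) (Fin g) ℂ) :
    Matrix (Fin (symDim g + 1)) (Fin (symDim g + 1)) ℂ :=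
  fun r k => Fin.cases (secondThetaConst (ε k) τ)
    (fun r' => tauDeriv (symPair g r').1 (symPair g r').2 (secondThetaConst (ε k)) τ) r

/-- The symmetric matrix `C_{εδ}(τ)` with entries `2 ∂_i θ[ε,δ](τ,0) ∂_j θ[ε,δ](τ,0)`. -/
def gradSquare {g : ℕ} (ε δ : HalfChar g) (τ : Matrix (Fin g) (Fin g) ℂ) :
    Matrix (Fin g) (Fin g) ℂ :=
  fun i j => 2 * thetaGrad ε δ τ i * thetaGrad ε δ τ j

/-- The vector in `ℂ^N` of the entries `C_{εδ,ij}(τ)`, `i ≤ j`. -/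
def gradSquareVec {g : ℕ} (ε δ : HalfChar g) (τ : Matrix (Fin g) (Fin g) ℂ) :
    Fin (symDim g) → ℂ :=
  fun r => gradSquare ε δ τ (symPair g r).1 (symPair g r).2

/-- The sign `(-1)^(α·β)`. -/
def charSign {g : ℕ} (α β : HalfChar g) : ℂ := (-1) ^ (α ⬝ᵥ β).val

/-- The signed sum of `N × N` determinants
`∑_{β_1,…,β_N} (∏_k (-1)^(ε_k·β_k)) det (C_{δ_1 β_1}, …, C_{δ_N β_N})` with `δ_k = ε_0 + ε_k`. -/
def signedDetSum {g : ℕ} (ε : Fin (symDim g + 1) → HalfChar g)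
    (τ : Matrix (Fin g) (Fin g) ℂ) : ℂ :=
  ∑ β : Fin (symDim g) → HalfChar g,
    (∏ k, charSign (ε k.succ) (β k)) *
      Matrix.det (Matrix.of fun r k => gradSquareVec (ε 0 + ε k.succ) (β k) τ r)

/-- Odd characteristics `[ε, δ]`: those with `ε·δ = 1` in `ℤ/2ℤ`. -/
abbrev OddChar (g : ℕ) : Type := {p : HalfChar g × HalfChar g // p.1 ⬝ᵥ p.2 = 1}

/-- The jacobian determinant `D([ε_1,δ_1],…,[ε_g,δ_g])(τ)` of `g` odd characteristics. -/
def jacobianDet {g : ℕ} (c : Fin g → OddChar g) (τ : Matrix (Fin g) (Fin g) ℂ) : ℂ :=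
  ((Real.pi : ℂ) ^ g)⁻¹ *
    Matrix.det (Matrix.of fun i k => thetaGrad (c k).1.1 (c k).1.2 τ i)

end

/-!
Riemann's change of variables `u = (a + b) / 2`, `v = (a - b) / 2` turns the double series for a
product of two gradients of theta functions into second order theta series. Summing over the second
characteristic `β` against the character `(-1)^(ε_k·β)` selects the single class in which `u` runs
through `ℤ^g + ε_k / 2` and `v` through `ℤ^g + ε_0 / 2`. The mixed terms vanish because the Gaussian
weights are even, and by the heat equation the second moments are `τ`-derivatives of theta
constants. Thus the signed sum of the vectors `C_{δ_k β}` is a multiple of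
`Θ[ε_0] ∂Θ[ε_k] - Θ[ε_k] ∂Θ[ε_0]` (`sum_charSign_mul_gradSquare`). The determinant of these vectors
is the condensation of `det M` along its first row and column (`pow_mul_det_succ`), which gives the
formula, also where `Θ[ε_0]` vanishes.

For the polynomial in jacobian determinants, gradients with even characteristic vanish, so all
characteristics may be taken odd, and it remains to express the determinant `f(V)` of the symmetric
squares of the `N` columns of `V` by the maximal minors of `V`. It satisfies
`f(A V) = det(A)^(g+1) f(V)`: the determinant of the symmetric square of `A` is multiplicative in
`A`, trivial on transvections, and known on diagonal matrices (`det_symSquare`). Pairing both sides,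
as polynomials in `A`, with `det ^ (g + 1)` in the Fischer inner product gives `f(V)` times the
norm of `det ^ (g + 1)`, which is positive, on the right, and on the left a sum of products of
`g + 1` minors (`sum_fischerCoeff_mul_eq_sum_prod_det`). This is the argument of Cayley's Omega
process, with the Fischer norm in place of Cayley's identity. Polynomials in `A` are represented by
tuples of column indices, one tuple for each way to write a monomial as an ordered product.
-/

open scoped BigOperators

/-! ### Gaussian bounds and termwise differentiation -/

theorem summable_fin_prod {f : ℤ → ℝ} (h0 : ∀ n, 0 ≤ f n) (hf : Summable f) (g : ℕ) :
    Summable fun m : Fin g → ℤ => ∏ i, f (m i) := by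
  induction g with
  | zero => exact (hasSum_fintype _).summable
  | succ g ih =>
    rw [← (Fin.consEquiv fun _ => ℤ).summable_iff]
    have := hf.mul_of_nonneg ih h0 fun m => Finset.prod_nonneg fun i _ => h0 _
    refine this.congr fun p => ?_
    simp [Fin.prod_univ_succ, Fin.consEquiv]

theorem summable_exp_neg_sq {c : ℝ} (hc : 0 < c) (g : ℕ) :
    Summable fun m : Fin g → ℤ => Real.exp (-(c * ∑ i, (m i : ℝ) ^ 2)) := by
  have h1 : Summable fun n : ℤ => Real.exp (-(c * (n : ℝ) ^ 2)) := by
    have := summable_pow_mul_jacobiTheta₂_term_bound 0 (T := c / Real.pi) (by positivity) 0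
    refine this.congr fun n => ?_
    have := Real.pi_ne_zero
    simp only [pow_zero, one_mul]
    congr 1
    field_simp
    simp
  refine (summable_fin_prod (fun n => (Real.exp_pos _).le) h1 g).congr fun m => ?_
  rw [← Real.exp_sum, Finset.mul_sum, Finset.sum_neg_distrib]

theorem Matrix.PosDef.exists_pos_mul_sum_sq_le {g : ℕ} {A : Matrix (Fin g) (Fin g) ℝ}
    (hA : A.PosDef) : ∃ c > 0, ∀ x : Fin g → ℝ, c * ∑ i, x i ^ 2 ≤ x ⬝ᵥ A.mulVec x := by
  have hcont : Continuous fun x : EuclideanSpace ℝ (Fin g) => x.ofLp ⬝ᵥ A.mulVec x.ofLp := by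
    simp only [dotProduct, Matrix.mulVec]
    fun_prop
  have key : ∃ c > 0, ∀ x ∈ Metric.sphere (0 : EuclideanSpace ℝ (Fin g)) 1,
      c ≤ x.ofLp ⬝ᵥ A.mulVec x.ofLp := by
    rcases (Metric.sphere (0 : EuclideanSpace ℝ (Fin g)) 1).eq_empty_or_nonempty with h | h
    · exact ⟨1, one_pos, by simp [h]⟩
    · obtain ⟨x₀, hx₀, hmin⟩ := (isCompact_sphere _ _).exists_isMinOn h hcont.continuousOn
      refine ⟨_, ?_, fun x hx => hmin hx⟩
      have hne : x₀.ofLp ≠ 0 := by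
        intro h0
        have : x₀ = 0 := by ext i; simpa using congrFun h0 i
        simp [this] at hx₀
      simpa using hA.dotProduct_mulVec_pos hne
  obtain ⟨c, hc, h⟩ := key
  refine ⟨c, hc, fun x => ?_⟩
  by_cases hx : x = 0
  · simp [hx]
  set y : EuclideanSpace ℝ (Fin g) := WithLp.toLp 2 x with hy
  have hsq : ∑ i, x i ^ 2 = ‖y‖ ^ 2 := by simp [EuclideanSpace.norm_sq_eq, hy]
  have hpos : 0 < ‖y‖ := by
    rw [norm_pos_iff]
    intro h0
    exact hx (by simpa [hy] using h0)
  have := h (‖y‖⁻¹ • y) (by simp [norm_smul, hpos.ne'])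
  simp only [WithLp.ofLp_smul, hy, Matrix.mulVec_smul, smul_dotProduct, dotProduct_smul,
    smul_eq_mul] at this
  rw [← hy] at this
  rw [hsq]
  have h2 := mul_le_mul_of_nonneg_right this (sq_nonneg ‖y‖)
  calc _ ≤ _ := h2
    _ = _ := by field_simp

/-- Termwise differentiation at `0` of a series `∑ exp (π i (q m + t l m))` whose exponents have
imaginary parts growing quadratically in `m`, uniformly for small `t`. -/
theorem hasSum_deriv_tsum_exp {g : ℕ} {q l : (Fin g → ℤ) → ℂ} {c r K : ℝ} (hc : 0 < c) (hr : 0 < r)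
    (h : ∀ m t, ‖t‖ < r → c * ∑ i, (m i : ℝ) ^ 2 - K ≤ (q m + t * l m).im) :
    HasSum (fun m => Real.pi * Complex.I * l m * Complex.exp (Real.pi * Complex.I * q m))
      (deriv (fun t => ∑' m, Complex.exp (Real.pi * Complex.I * (q m + t * l m))) 0) := by
  have hd : ∀ m (t : ℂ), HasDerivAt
      (fun t => Complex.exp (Real.pi * Complex.I * (q m + t * l m)))
      (Real.pi * Complex.I * l m * Complex.exp (Real.pi * Complex.I * (q m + t * l m))) t := by
    intro m t
    have := ((((hasDerivAt_id t).mul_const (l m)).const_add (q m)).const_mul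
      (Real.pi * Complex.I : ℂ)).cexp
    convert! this using 1
    simp only [id]
    ring
  have hu : Summable fun m : Fin g → ℤ => Real.exp (Real.pi * K) *
      Real.exp (-((Real.pi * c) * ∑ i, (m i : ℝ) ^ 2)) :=
    (summable_exp_neg_sq (by positivity) g).mul_left _
  have := Complex.hasSum_deriv_of_summable_norm (U := Metric.ball 0 r) (z := 0) hu
    (F := fun m t => Complex.exp (Real.pi * Complex.I * (q m + t * l m)))
    (fun m t _ => (hd m t).differentiableAt.differentiableWithinAt) Metric.isOpen_ball
    (fun m t ht => by
      rw [mem_ball_zero_iff] at ht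
      rw [Complex.norm_exp, ← Real.exp_add, Real.exp_le_exp]
      have := mul_le_mul_of_nonneg_left (h m t ht) Real.pi_pos.le
      have h2 : (Real.pi * Complex.I * (q m + t * l m) : ℂ).re =
          -(Real.pi * (q m + t * l m).im) := by
        simp only [mul_assoc, Complex.re_ofReal_mul, Complex.I_mul_re]; ring
      rw [h2]
      linarith)
    (Metric.mem_ball_self hr)
  convert! this using 1
  ext m
  rw [(hd m 0).deriv]
  simp

theorem summable_exp_of_le_im {g : ℕ} {q : (Fin g → ℤ) → ℂ} {c K : ℝ} (hc : 0 < c)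
    (h : ∀ m, c * ∑ i, (m i : ℝ) ^ 2 - K ≤ (q m).im) :
    Summable fun m => Complex.exp (Real.pi * Complex.I * q m) := by
  -- the derived series of `exp (π i (q m + t l))` is the original one if `l = 1 / (π i)`
  have := (hasSum_deriv_tsum_exp (q := q) (l := fun _ => 1 / (Real.pi * Complex.I)) (K := K + 1)
    hc one_pos (fun m t ht => ?_)).summable
  · have hp : (Real.pi : ℂ) ≠ 0 := by exact_mod_cast Real.pi_ne_zero
    refine this.congr fun m => ?_
    have := Complex.I_ne_zero
    field_simp
  · have h1 : ‖t * (1 / (Real.pi * Complex.I))‖ ≤ 1 := by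
      rw [norm_mul]
      have : ‖(1 / (Real.pi * Complex.I) : ℂ)‖ ≤ 1 := by
        rw [norm_div, norm_mul, Complex.norm_I, Complex.norm_real, Real.norm_eq_abs,
          abs_of_pos Real.pi_pos, norm_one, mul_one, div_le_one Real.pi_pos]
        linarith [Real.pi_gt_three]
      nlinarith [norm_nonneg t, norm_nonneg (1 / (Real.pi * Complex.I) : ℂ)]
    have h2 := (abs_le.1 ((Complex.abs_im_le_norm (t * (1 / (Real.pi * Complex.I)))).trans h1)).1
    rw [Complex.add_im]
    linarith [h m]

/-! ### The points of a shifted lattice -/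

/-- The real vector `m + ε / 2`, for `m ∈ ℤ^g`. -/
noncomputable def latticePt {g : ℕ} (ε : HalfChar g) (m : Fin g → ℤ) : Fin g → ℝ :=
  fun i => m i + ((ε i).val : ℝ) / 2

theorem intCast_add_half {g : ℕ} (ε : HalfChar g) (m : Fin g → ℤ) :
    (fun i => (m i : ℂ) + ε.half i) = fun i => (latticePt ε m i : ℂ) := by
  ext i
  simp [latticePt, HalfChar.half, -ZMod.natCast_val]

theorem half_sum_sq_sub_le {g : ℕ} (ε : HalfChar g) (m : Fin g → ℤ) :
    (1 / 2) * ∑ i, (m i : ℝ) ^ 2 - g ≤ ∑ i, latticePt ε m i ^ 2 := by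
  have : ∀ i, (1 / 2) * (m i : ℝ) ^ 2 - 1 ≤ latticePt ε m i ^ 2 := by
    intro i
    have h1 : ((ε i).val : ℝ) ≤ 1 := by exact_mod_cast Nat.lt_succ_iff.1 (ZMod.val_lt (ε i))
    have h0 : (0 : ℝ) ≤ ((ε i).val : ℝ) := by positivity
    rw [latticePt]
    nlinarith [sq_nonneg ((m i : ℝ) + (ε i).val)]
  calc _ = ∑ i, ((1 / 2) * (m i : ℝ) ^ 2 - 1) := by simp [Finset.mul_sum]
    _ ≤ _ := Finset.sum_le_sum fun i _ => this i

theorem im_quadForm {g : ℕ} (τ : Matrix (Fin g) (Fin g) ℂ) (x : Fin g → ℝ) :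
    ((fun i => (x i : ℂ)) ⬝ᵥ τ.mulVec fun i => (x i : ℂ)).im
      = x ⬝ᵥ (τ.map Complex.im).mulVec x := by
  simp [dotProduct, Matrix.mulVec, Complex.im_sum]

/-- The quadratic form `ᵗx τ x` at a real vector `x`. -/
noncomputable def quadForm {g : ℕ} (τ : Matrix (Fin g) (Fin g) ℂ) (x : Fin g → ℝ) : ℂ :=
  (fun i => (x i : ℂ)) ⬝ᵥ τ.mulVec fun i => (x i : ℂ)

theorem exists_le_im_quadForm {g : ℕ} {τ : Matrix (Fin g) (Fin g) ℂ}
    (hτ : τ ∈ SiegelUpperHalfSpace g) :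
    ∃ c > 0, ∀ x : Fin g → ℝ, c * ∑ i, x i ^ 2 ≤ (quadForm τ x).im := by
  obtain ⟨c, hc, h⟩ := hτ.2.exists_pos_mul_sum_sq_le
  exact ⟨c, hc, fun x => (h x).trans_eq (im_quadForm τ x).symm⟩

theorem le_im_quadForm_add {g : ℕ} {τ : Matrix (Fin g) (Fin g) ℂ} {c : ℝ} (hc : 0 < c)
    (h : ∀ x : Fin g → ℝ, c * ∑ i, x i ^ 2 ≤ (quadForm τ x).im) (ε : HalfChar g)
    (m : Fin g → ℤ) (b : ℝ) (i : Fin g) (t : ℂ) (ht : ‖t‖ < 1) :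
    c / 4 * ∑ i, (m i : ℝ) ^ 2 - (c / 2 * g + 2 / c) ≤
      (quadForm τ (latticePt ε m) + b + t * (2 * latticePt ε m i)).im := by
  have h1 := h (latticePt ε m)
  have h2 := half_sum_sq_sub_le ε m
  have h3 : latticePt ε m i ^ 2 ≤ ∑ i, latticePt ε m i ^ 2 :=
    Finset.single_le_sum (f := fun i => latticePt ε m i ^ 2) (fun _ _ => sq_nonneg _)
      (Finset.mem_univ i)
  set a := latticePt ε m i
  have h4 : (t * (2 * a)).im = t.im * (2 * a) := by
    simp
  have h5 : |t.im| ≤ 1 := (Complex.abs_im_le_norm t).trans ht.le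
  have h6 : -(2 * |a|) ≤ t.im * (2 * a) := by
    have : |t.im * (2 * a)| ≤ 2 * |a| := by
      rw [abs_mul, abs_mul, abs_two]
      nlinarith [abs_nonneg a]
    linarith [(abs_le.1 this).1]
  -- completing the square absorbs the linear term into half of the quadratic one
  have h7 : 0 ≤ c / 2 * a ^ 2 - 2 * |a| + 2 / c := by
    have : c / 2 * a ^ 2 - 2 * |a| + 2 / c = c / 2 * (|a| - 2 / c) ^ 2 := by
      rw [← sq_abs a]; field_simp; ring
    rw [this]; positivity
  simp only [Complex.add_im, Complex.ofReal_im, h4]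
  nlinarith

theorem exp_pi_I_quadForm_add {g : ℕ} {τ : Matrix (Fin g) (Fin g) ℂ}
    (hτ : τ ∈ SiegelUpperHalfSpace g) (ε : HalfChar g) (b : (Fin g → ℤ) → ℝ) :
    (Summable fun m => Complex.exp (Real.pi * Complex.I * (quadForm τ (latticePt ε m) + b m))) ∧
    ∀ i, HasSum (fun m => Real.pi * Complex.I * (2 * latticePt ε m i) *
        Complex.exp (Real.pi * Complex.I * (quadForm τ (latticePt ε m) + b m)))
      (deriv (fun t : ℂ => ∑' m, Complex.exp (Real.pi * Complex.I *
        (quadForm τ (latticePt ε m) + b m + t * (2 * latticePt ε m i)))) 0) := by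
  obtain ⟨c, hc, h⟩ := exists_le_im_quadForm hτ
  refine ⟨summable_exp_of_le_im (c := c / 2) (K := c * g) (by positivity) fun m => ?_, fun i =>
    hasSum_deriv_tsum_exp (by positivity) one_pos fun m t ht =>
      le_im_quadForm_add hc h ε m (b m) i t ht⟩
  have h1 := h (latticePt ε m)
  have h2 := half_sum_sq_sub_le ε m
  simp only [Complex.add_im, Complex.ofReal_im]
  nlinarith

theorem quadForm_symUnit {g : ℕ} (i j : Fin g) (x : Fin g → ℝ) :
    quadForm (symUnit i j) x = ((if i = j then 1 else 2 : ℝ) * (x i * x j) : ℝ) := by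
  have : ∀ a b, symUnit i j a b =
      (if a = i then if b = j then 1 else 0 else 0) +
        (if i = j then 0 else if a = j then if b = i then 1 else 0 else 0 : ℂ) := by
    intro a b
    unfold symUnit
    split_ifs <;> grind
  simp only [quadForm, dotProduct, Matrix.mulVec, this]
  split_ifs with h
  · subst h; simp
  · simp [add_mul, mul_add, Finset.sum_add_distrib]; ring

theorem quadForm_two_smul {g : ℕ} (τ : Matrix (Fin g) (Fin g) ℂ) (x : Fin g → ℝ) :
    quadForm ((2 : ℂ) • τ) x = 2 * quadForm τ x := by
  simp [quadForm, Matrix.smul_mulVec]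

theorem two_smul_mem_siegel {g : ℕ} {τ : Matrix (Fin g) (Fin g) ℂ}
    (hτ : τ ∈ SiegelUpperHalfSpace g) : (2 : ℂ) • τ ∈ SiegelUpperHalfSpace g := by
  refine ⟨by simp [Matrix.IsSymm, hτ.1.eq], ?_⟩
  have : ((2 : ℂ) • τ).map Complex.im = (2 : ℝ) • τ.map Complex.im := by
    ext i j; simp
  rw [this]
  exact hτ.2.smul two_pos

theorem exp_quadForm_symUnit {g : ℕ} {τ : Matrix (Fin g) (Fin g) ℂ}
    (hτ : τ ∈ SiegelUpperHalfSpace g) (ε : HalfChar g) (i j : Fin g) :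
    HasSum (fun m => Real.pi * Complex.I * (2 * quadForm (symUnit i j) (latticePt ε m)) *
        Complex.exp (Real.pi * Complex.I * (2 * quadForm τ (latticePt ε m))))
      (deriv (fun t : ℂ => ∑' m, Complex.exp (Real.pi * Complex.I *
        (2 * quadForm τ (latticePt ε m) +
          t * (2 * quadForm (symUnit i j) (latticePt ε m))))) 0) := by
  obtain ⟨c, hc, h⟩ := exists_le_im_quadForm hτ
  -- for `‖t‖ < c / 4` the perturbation costs at most half of the bound `2 c |x|²`
  refine hasSum_deriv_tsum_exp (c := c / 2) (r := c / 4) (K := c * g) (by positivity)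
    (by positivity) fun m t ht => ?_
  have h1 := h (latticePt ε m)
  have h2 := half_sum_sq_sub_le ε m
  have h3 : ∀ i, latticePt ε m i ^ 2 ≤ ∑ i, latticePt ε m i ^ 2 := fun i =>
    Finset.single_le_sum (f := fun i => latticePt ε m i ^ 2) (fun _ _ => sq_nonneg _)
      (Finset.mem_univ i)
  have h3i := h3 i
  have h3j := h3 j
  rw [quadForm_symUnit]
  set κ : ℝ := if i = j then 1 else 2
  have hκ : 0 ≤ κ ∧ κ ≤ 2 := by simp only [κ]; split_ifs <;> norm_num
  set a := latticePt ε m i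
  set b := latticePt ε m j
  set S := ∑ i, latticePt ε m i ^ 2
  have h4 : |κ * (a * b)| ≤ 2 * S := by
    rw [abs_mul, abs_of_nonneg hκ.1]
    have : |a * b| ≤ S := by
      rw [abs_le]; constructor <;> nlinarith [sq_nonneg (a + b), sq_nonneg (a - b)]
    nlinarith [abs_nonneg (a * b)]
  have h5 : |t.im| ≤ c / 4 := (Complex.abs_im_le_norm t).trans ht.le
  have h6 : |t.im * (2 * (κ * (a * b)))| ≤ c / 4 * (2 * (2 * S)) := by
    rw [abs_mul, abs_mul, abs_two]
    gcongr
  have h7 := (abs_le.1 h6).1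
  have h8 : (2 * quadForm τ (latticePt ε m) + t * (2 * ((κ * (a * b) : ℝ) : ℂ))).im
      = 2 * (quadForm τ (latticePt ε m)).im + t.im * (2 * (κ * (a * b))) := by
    have : t * (2 * ((κ * (a * b) : ℝ) : ℂ)) = t * ((2 * (κ * (a * b)) : ℝ) : ℂ) := by
      push_cast; ring
    rw [this]
    simp [-Complex.ofReal_mul]
  rw [h8]
  nlinarith

/-! ### Series for gradients and second order theta constants -/

theorem quadForm_add_add_sub {g : ℕ} (τ : Matrix (Fin g) (Fin g) ℂ) (u v : Fin g → ℝ) :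
    quadForm τ (u + v) + quadForm τ (u - v) = 2 * quadForm τ u + 2 * quadForm τ v := by
  have h1 : (fun i => ((u + v) i : ℂ)) = (fun i => (u i : ℂ)) + fun i => (v i : ℂ) := by
    ext i; simp
  have h2 : (fun i => ((u - v) i : ℂ)) = (fun i => (u i : ℂ)) - fun i => (v i : ℂ) := by
    ext i; simp
  simp only [quadForm, h1, h2, Matrix.mulVec_add, Matrix.mulVec_sub, dotProduct_add,
    dotProduct_sub, add_dotProduct, sub_dotProduct]
  ring

theorem quadForm_neg {g : ℕ} (τ : Matrix (Fin g) (Fin g) ℂ) (u : Fin g → ℝ) :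
    quadForm τ (-u) = quadForm τ u := by
  have h1 : (fun i => ((-u) i : ℂ)) = -fun i => (u i : ℂ) := by
    ext i; simp
  simp only [quadForm, h1, Matrix.mulVec_neg, dotProduct_neg, neg_dotProduct, neg_neg]

/-- The pairing `x · δ` of a vector with a characteristic, whose entries are read as `0` or `1`. -/
noncomputable def charPairing {g : ℕ} (x : Fin g → ℝ) (δ : HalfChar g) : ℝ :=
  ∑ k, x k * (δ k).val

theorem two_mul_dotProduct_half {g : ℕ} (x : Fin g → ℝ) (δ : HalfChar g) :
    2 * ((fun i => (x i : ℂ)) ⬝ᵥ δ.half) = charPairing x δ := by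
  simp only [dotProduct, HalfChar.half, charPairing, Finset.mul_sum, Complex.ofReal_sum]
  refine Finset.sum_congr rfl fun k _ => ?_
  push_cast
  ring

theorem hasSum_thetaGrad {g : ℕ} {τ : Matrix (Fin g) (Fin g) ℂ} (hτ : τ ∈ SiegelUpperHalfSpace g)
    (ε δ : HalfChar g) (i : Fin g) :
    HasSum (fun m => Real.pi * Complex.I * (2 * latticePt ε m i) * Complex.exp
      (Real.pi * Complex.I * (quadForm τ (latticePt ε m) + charPairing (latticePt ε m) δ)))
      (thetaGrad ε δ τ i) := by
  have := (exp_pi_I_quadForm_add hτ ε fun m => charPairing (latticePt ε m) δ).2 i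
  unfold thetaGrad thetaChar
  convert! this using 7 with t m
  rw [intCast_add_half, dotProduct_add, mul_add, two_mul_dotProduct_half, quadForm]
  simp only [dotProduct_single]
  ring

theorem secondThetaConst_eq_tsum {g : ℕ} (ε : HalfChar g) (τ : Matrix (Fin g) (Fin g) ℂ) :
    secondThetaConst ε τ =
      ∑' m, Complex.exp (Real.pi * Complex.I * (2 * quadForm τ (latticePt ε m))) := by
  unfold secondThetaConst secondTheta thetaChar
  congr 1
  ext m
  rw [intCast_add_half, ← quadForm, quadForm_two_smul]
  have : (0 : HalfChar g).half = 0 := by ext; simp [HalfChar.half]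
  simp [this]

theorem hasSum_secondThetaConst {g : ℕ} {τ : Matrix (Fin g) (Fin g) ℂ}
    (hτ : τ ∈ SiegelUpperHalfSpace g) (ε : HalfChar g) :
    HasSum (fun m => Complex.exp (Real.pi * Complex.I * (2 * quadForm τ (latticePt ε m))))
      (secondThetaConst ε τ) := by
  rw [secondThetaConst_eq_tsum]
  have := (exp_pi_I_quadForm_add (two_smul_mem_siegel hτ) ε fun _ => 0).1
  simp only [quadForm_two_smul, Complex.ofReal_zero, add_zero] at this
  exact this.hasSum

theorem quadForm_add_smul {g : ℕ} (τ σ : Matrix (Fin g) (Fin g) ℂ) (t : ℂ) (x : Fin g → ℝ) :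
    quadForm (τ + t • σ) x = quadForm τ x + t * quadForm σ x := by
  simp [quadForm, Matrix.add_mulVec, Matrix.smul_mulVec]

/-- The second moments of the Gaussian weights are multiples of the `τ`-derivatives of the second
order theta constants: this is the heat equation. -/
theorem hasSum_tauDeriv {g : ℕ} {τ : Matrix (Fin g) (Fin g) ℂ}
    (hτ : τ ∈ SiegelUpperHalfSpace g) (ε : HalfChar g) (i j : Fin g) :
    HasSum (fun m => (latticePt ε m i * latticePt ε m j : ℂ) *
        Complex.exp (Real.pi * Complex.I * (2 * quadForm τ (latticePt ε m))))
      ((2 * Real.pi * Complex.I * (if i = j then 1 else 2))⁻¹ *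
        tauDeriv i j (secondThetaConst ε) τ) := by
  have hp : (Real.pi : ℂ) ≠ 0 := by exact_mod_cast Real.pi_ne_zero
  have hI := Complex.I_ne_zero
  have := (exp_quadForm_symUnit hτ ε i j).mul_left
    (2 * Real.pi * Complex.I * (if i = j then 1 else 2 : ℂ))⁻¹
  convert! this using 1
  · ext m
    rw [quadForm_symUnit]
    split_ifs <;> · push_cast; field_simp
  · unfold tauDeriv
    simp only [secondThetaConst_eq_tsum, quadForm_add_smul]
    congr 3
    ext t
    congr 1
    ext m
    ring_nf

/-- The involution of `ℤ^g` that corresponds to `x ↦ -x` on the shifted lattice `ℤ^g + ε / 2`. -/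
def negShift {g : ℕ} (ε : HalfChar g) : (Fin g → ℤ) ≃ (Fin g → ℤ) :=
  Function.Involutive.toPerm (fun m i => -m i - (ε i).val) fun m => by ext i; simp

theorem latticePt_negShift {g : ℕ} (ε : HalfChar g) (m : Fin g → ℤ) :
    latticePt ε (negShift ε m) = -latticePt ε m := by
  ext i
  have : negShift ε m i = -m i - (ε i).val := rfl
  simp only [latticePt, this, Pi.neg_apply]
  push_cast
  ring

/-- The first moments of the Gaussian weights exist and vanish, the weights being even. -/
theorem hasSum_latticePt_mul_exp {g : ℕ} {τ : Matrix (Fin g) (Fin g) ℂ}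
    (hτ : τ ∈ SiegelUpperHalfSpace g) (ε : HalfChar g) (i : Fin g) :
    HasSum (fun m => (latticePt ε m i : ℂ) *
      Complex.exp (Real.pi * Complex.I * (2 * quadForm τ (latticePt ε m)))) 0 := by
  have hp : (Real.pi : ℂ) ≠ 0 := by exact_mod_cast Real.pi_ne_zero
  have hI := Complex.I_ne_zero
  have h := ((exp_pi_I_quadForm_add (two_smul_mem_siegel hτ) ε fun _ => 0).2 i).mul_left
    (2 * Real.pi * Complex.I)⁻¹
  simp only [quadForm_two_smul, Complex.ofReal_zero, add_zero] at h
  have h0 : ∀ m, (2 * Real.pi * Complex.I)⁻¹ * (Real.pi * Complex.I * (2 * latticePt ε m i) *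
      Complex.exp (Real.pi * Complex.I * (2 * quadForm τ (latticePt ε m)))) =
      latticePt ε m i * Complex.exp (Real.pi * Complex.I * (2 * quadForm τ (latticePt ε m))) := by
    intro m
    field_simp
  have h1 := h
  simp only [h0] at h1
  have h2 := (negShift ε).hasSum_iff.2 h1
  have h3 := h1.neg
  have h4 := h2.unique (by
    convert! h3 using 2 with m
    simp [latticePt_negShift, quadForm_neg])
  rw [self_eq_neg] at h4
  rwa [h4] at h1

theorem cast_sum_val_mul_val {g : ℕ} (ε δ : HalfChar g) :
    ((∑ k, (ε k).val * (δ k).val : ℕ) : ZMod 2) = ε ⬝ᵥ δ := by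
  simp [dotProduct]

/-- Theta functions with even characteristic are even, so their gradients vanish. -/
theorem thetaGrad_eq_zero_of_ne_one {g : ℕ} {τ : Matrix (Fin g) (Fin g) ℂ}
    (hτ : τ ∈ SiegelUpperHalfSpace g) {ε δ : HalfChar g} (h : ε ⬝ᵥ δ ≠ 1) :
    thetaGrad ε δ τ = 0 := by
  have h0 : ε ⬝ᵥ δ = 0 := by
    generalize ε ⬝ᵥ δ = a at h
    revert a; decide
  rw [← cast_sum_val_mul_val, ZMod.natCast_eq_zero_iff_even] at h0
  obtain ⟨r, hr⟩ := h0
  ext i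
  have h1 := hasSum_thetaGrad hτ ε δ i
  have h2 := (negShift ε).hasSum_iff.2 h1
  have h3 := h2.unique (by
    convert! h1.neg using 2 with m
    simp only [Function.comp, latticePt_negShift, quadForm_neg, Pi.neg_apply]
    -- for an even characteristic the pairing with `δ` is an integer, so its sign is immaterial
    have hb : charPairing (latticePt ε m) δ = ((∑ k, m k * (δ k).val + r : ℤ) : ℝ) := by
      have hr' : (∑ k, ((ε k).val : ℝ) * (δ k).val) = r + r := by exact_mod_cast hr
      simp only [charPairing, latticePt, add_mul, Finset.sum_add_distrib, div_mul_eq_mul_div,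
        ← Finset.sum_div, hr']
      push_cast
      ring
    have hn : charPairing (-latticePt ε m) δ = -charPairing (latticePt ε m) δ := by
      simp [charPairing]
    rw [hn]
    generalize (∑ k, m k * (δ k).val + r : ℤ) = b at hb
    have : Complex.exp (Real.pi * Complex.I * (quadForm τ (latticePt ε m) +
        (-charPairing (latticePt ε m) δ : ℝ))) = Complex.exp (Real.pi * Complex.I *
        (quadForm τ (latticePt ε m) + charPairing (latticePt ε m) δ)) := by
      rw [Complex.exp_eq_exp_iff_exists_int]
      refine ⟨-b, ?_⟩
      rw [hb]
      push_cast
      ring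
    rw [this]
    push_cast
    ring)
  simpa [self_eq_neg] using h3

/-! ### The signed sum over the second characteristic -/

theorem charSign_eq_prod {g : ℕ} (α β : HalfChar g) :
    charSign α β = ∏ k, (-1 : ℂ) ^ ((α k).val * (β k).val) := by
  rw [charSign, ← cast_sum_val_mul_val, ZMod.val_natCast, Finset.prod_pow_eq_pow_sum,
    neg_one_pow_eq_pow_mod_two (n := ∑ k, _)]

theorem exp_pi_I_mul_int (s : ℤ) : Complex.exp (Real.pi * Complex.I * s) = (-1) ^ s := by
  rw [mul_comm, Complex.exp_int_mul, Complex.exp_pi_mul_I]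

theorem neg_one_pow_mul_zpow (a : ZMod 2) (s : ℤ) :
    (-1 : ℂ) ^ a.val * (-1) ^ s = if (s : ZMod 2) = a then 1 else -1 := by
  rcases Int.even_or_odd s with hs | hs
  · have h0 : (s : ZMod 2) = 0 := (ZMod.intCast_zmod_eq_zero_iff_dvd s 2).2 (by
      exact_mod_cast hs.two_dvd)
    rw [hs.neg_one_zpow, h0]
    obtain rfl | rfl : a = 0 ∨ a = 1 := by revert a; decide
    · simp
    · simp [ZMod.val_one]
  · have h0 : (s : ZMod 2) = 1 := by
      obtain ⟨k, rfl⟩ := hs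
      have : (2 : ZMod 2) = 0 := rfl
      simp [this]
    rw [hs.neg_one_zpow, h0]
    obtain rfl | rfl : a = 0 ∨ a = 1 := by revert a; decide
    · simp
    · simp [ZMod.val_one]

/-- Orthogonality of the characters of `(ℤ/2ℤ)^g`. -/
theorem sum_charSign_mul_exp {g : ℕ} (γ : HalfChar g) (s : Fin g → ℤ) :
    ∑ β : HalfChar g, charSign γ β *
        Complex.exp (Real.pi * Complex.I * charPairing (fun k => (s k : ℝ)) β)
      = if ∀ k, (s k : ZMod 2) = γ k then 2 ^ g else 0 := by
  have h1 : ∀ β : HalfChar g, charSign γ β *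
      Complex.exp (Real.pi * Complex.I * charPairing (fun k => (s k : ℝ)) β)
      = ∏ k, ((-1 : ℂ) ^ ((γ k).val * (β k).val) * ((-1) ^ s k) ^ (β k).val) := by
    intro β
    rw [charSign_eq_prod, Finset.prod_mul_distrib, charPairing, Complex.ofReal_sum, Finset.mul_sum,
      Complex.exp_sum]
    congr 1
    refine Finset.prod_congr rfl fun k _ => ?_
    rw [← exp_pi_I_mul_int, ← Complex.exp_nat_mul]
    congr 1
    push_cast
    ring
  simp only [h1]
  have h2 := Finset.prod_univ_sum (fun _ : Fin g => (Finset.univ : Finset (ZMod 2)))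
    (fun k b => (-1 : ℂ) ^ ((γ k).val * b.val) * ((-1) ^ s k) ^ b.val)
  rw [Fintype.piFinset_univ] at h2
  rw [← h2]
  have h3 : ∀ k, ∑ b : ZMod 2, (-1 : ℂ) ^ ((γ k).val * b.val) * ((-1) ^ s k) ^ b.val
      = if (s k : ZMod 2) = γ k then 2 else 0 := by
    intro k
    have : (Finset.univ : Finset (ZMod 2)) = {0, 1} := rfl
    rw [this, Finset.sum_pair (by decide)]
    have hv : (1 : ZMod 2).val = 1 := rfl
    rw [ZMod.val_zero, hv, mul_zero, pow_zero, pow_zero, mul_one, pow_one, mul_one,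
      neg_one_pow_mul_zpow]
    split_ifs <;> norm_num
  simp only [h3]
  split_ifs with h
  · simp [h]
  · push Not at h
    obtain ⟨k, hk⟩ := h
    exact Finset.prod_eq_zero (Finset.mem_univ k) (if_neg hk)

/-- The change of variables on pairs of lattice points: if `p, q` correspond to `u ∈ ℤ^g + γ / 2`
and `v ∈ ℤ^g + α / 2`, the image corresponds to `u + v` and `u - v`, in `ℤ^g + (α + γ) / 2`. -/
def addSubPair {g : ℕ} (α γ : HalfChar g) (p : (Fin g → ℤ) × (Fin g → ℤ)) :
    (Fin g → ℤ) × (Fin g → ℤ) :=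
  (fun k => p.1 k + p.2 k + (α k).val * (γ k).val,
    fun k => p.1 k - p.2 k - (α k).val + (α k).val * (γ k).val)

theorem ZMod.two_val_add (a b : ZMod 2) :
    ((a + b).val : ℤ) = a.val + b.val - 2 * (a.val * b.val) := by
  revert a b; decide

theorem latticePt_addSubPair_fst {g : ℕ} (α γ : HalfChar g) (p : (Fin g → ℤ) × (Fin g → ℤ)) :
    latticePt (α + γ) (addSubPair α γ p).1 = latticePt γ p.1 + latticePt α p.2 := by
  ext k
  have : (((α k + γ k).val : ℤ) : ℝ) = _ := congrArg Int.cast (ZMod.two_val_add (α k) (γ k))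
  simp only [latticePt, addSubPair, Pi.add_apply]
  push_cast at this ⊢
  rw [this]
  ring

theorem latticePt_addSubPair_snd {g : ℕ} (α γ : HalfChar g) (p : (Fin g → ℤ) × (Fin g → ℤ)) :
    latticePt (α + γ) (addSubPair α γ p).2 = latticePt γ p.1 - latticePt α p.2 := by
  ext k
  have : (((α k + γ k).val : ℤ) : ℝ) = _ := congrArg Int.cast (ZMod.two_val_add (α k) (γ k))
  simp only [latticePt, addSubPair, Pi.add_apply, Pi.sub_apply]
  push_cast at this ⊢
  rw [this]
  ring

theorem addSubPair_injective {g : ℕ} (α γ : HalfChar g) : Function.Injective (addSubPair α γ) := by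
  rintro ⟨p, q⟩ ⟨p', q'⟩ h
  simp only [addSubPair, Prod.mk.injEq] at h
  have h1 := fun k => congrFun h.1 k
  have h2 := fun k => congrFun h.2 k
  ext k <;> linarith [h1 k, h2 k]

theorem mem_range_addSubPair {g : ℕ} (α γ : HalfChar g) (m : (Fin g → ℤ) × (Fin g → ℤ))
    (h : ∀ k, ((m.1 k + m.2 k + ((α + γ) k).val : ℤ) : ZMod 2) = γ k) :
    m ∈ Set.range (addSubPair α γ) := by
  have h1 : ∀ k, ∃ r : ℤ, m.1 k + m.2 k + (α k + γ k).val - (γ k).val = 2 * r := by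
    intro k
    have := h k
    rw [← sub_eq_zero] at this
    have h2 : ((m.1 k + m.2 k + (α k + γ k).val - (γ k).val : ℤ) : ZMod 2) = 0 := by
      rw [← this]
      push_cast
      simp
    exact (ZMod.intCast_zmod_eq_zero_iff_dvd _ 2).1 h2
  choose r hr using h1
  refine ⟨(r, fun k => m.1 k - r k - (α k).val * (γ k).val), ?_⟩
  ext k
  · simp only [addSubPair]; ring
  · have := hr k
    rw [ZMod.two_val_add] at this
    simp only [addSubPair]
    linarith

theorem HasSum.mul_complex {ι κ : Type*} {f : ι → ℂ} {f' : κ → ℂ} {a b : ℂ} (hf : HasSum f a)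
    (hf' : HasSum f' b) : HasSum (fun p : ι × κ => f p.1 * f' p.2) (a * b) :=
  hf.mul hf' (summable_mul_of_summable_norm hf.summable.norm hf'.summable.norm)

/-- The signed sum over `β` of the products of gradients, rewritten by Riemann's change of
variables as a bilinear expression in second order theta constants and their derivatives. -/
theorem sum_charSign_mul_gradSquare {g : ℕ} {τ : Matrix (Fin g) (Fin g) ℂ}
    (hτ : τ ∈ SiegelUpperHalfSpace g) (α γ : HalfChar g) (i j : Fin g) :
    ∑ β, charSign γ β * gradSquare (α + γ) β τ i j =
      2 ^ (g + 2) * (Real.pi * Complex.I) / (if i = j then 1 else 2) *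
        (secondThetaConst α τ * tauDeriv i j (secondThetaConst γ) τ -
          secondThetaConst γ τ * tauDeriv i j (secondThetaConst α) τ) := by
  have hp : (Real.pi : ℂ) ≠ 0 := by exact_mod_cast Real.pi_ne_zero
  have hI := Complex.I_ne_zero
  -- the sum over `β` kills all pairs outside of the image of the change of variables
  have h1 := hasSum_sum (s := Finset.univ) fun (β : HalfChar g) _ =>
    ((hasSum_thetaGrad hτ (α + γ) β i).mul_complex (hasSum_thetaGrad hτ (α + γ) β j)).mul_left
      (charSign γ β)
  have h2 : ∀ m : (Fin g → ℤ) × (Fin g → ℤ),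
      (∑ β : HalfChar g, charSign γ β * ((Real.pi * Complex.I * (2 * latticePt (α + γ) m.1 i) *
        Complex.exp (Real.pi * Complex.I * (quadForm τ (latticePt (α + γ) m.1) +
          charPairing (latticePt (α + γ) m.1) β))) *
        (Real.pi * Complex.I * (2 * latticePt (α + γ) m.2 j) *
        Complex.exp (Real.pi * Complex.I * (quadForm τ (latticePt (α + γ) m.2) +
          charPairing (latticePt (α + γ) m.2) β))))) =
      (2 * Real.pi * Complex.I) ^ 2 * (latticePt (α + γ) m.1 i * latticePt (α + γ) m.2 j) *
        Complex.exp (Real.pi * Complex.I * (quadForm τ (latticePt (α + γ) m.1) +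
          quadForm τ (latticePt (α + γ) m.2))) *
        if ∀ k, ((m.1 k + m.2 k + ((α + γ) k).val : ℤ) : ZMod 2) = γ k then 2 ^ g else 0 := by
    intro m
    rw [← sum_charSign_mul_exp, Finset.mul_sum]
    refine Finset.sum_congr rfl fun β _ => ?_
    have hb : charPairing (fun k => ((m.1 k + m.2 k + ((α + γ) k).val : ℤ) : ℝ)) β =
        charPairing (latticePt (α + γ) m.1) β + charPairing (latticePt (α + γ) m.2) β := by
      simp only [charPairing, ← Finset.sum_add_distrib, latticePt]
      refine Finset.sum_congr rfl fun k _ => ?_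
      push_cast
      ring
    rw [hb, Complex.ofReal_add]
    simp only [mul_add, Complex.exp_add]
    ring
  simp only [h2] at h1
  rw [← (addSubPair_injective α γ).hasSum_iff (fun m hm => by
    rw [if_neg fun h => hm (mem_range_addSubPair α γ m h), mul_zero])] at h1
  -- the terms of the expansion of `(u + v)_i (u - v)_j`; the mixed ones have sum zero
  have h3 := (((((hasSum_tauDeriv hτ γ i j).mul_complex (hasSum_secondThetaConst hτ α)).sub
    ((hasSum_secondThetaConst hτ γ).mul_complex (hasSum_tauDeriv hτ α i j))).add
    ((hasSum_latticePt_mul_exp hτ γ j).mul_complex (hasSum_latticePt_mul_exp hτ α i))).sub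
    ((hasSum_latticePt_mul_exp hτ γ i).mul_complex (hasSum_latticePt_mul_exp hτ α j))).mul_left
    (2 ^ g * (2 * Real.pi * Complex.I) ^ 2)
  have h4 := h1.unique (by
    convert! h3 using 2 with p
    have hs : ∀ k, (((addSubPair α γ p).1 k + (addSubPair α γ p).2 k + ((α + γ) k).val : ℤ) :
        ZMod 2) = γ k := by
      intro k
      have h22 : (2 : ZMod 2) = 0 := rfl
      simp only [Pi.add_apply, ZMod.two_val_add, addSubPair]
      push_cast
      have : ((γ k).val : ZMod 2) = γ k := by simp
      rw [this]
      linear_combination ((p.1 k : ZMod 2)) * h22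
    rw [Function.comp_apply, if_pos hs]
    simp only [latticePt_addSubPair_fst, latticePt_addSubPair_snd,
      quadForm_add_add_sub, mul_add, Complex.exp_add, Pi.add_apply, Pi.sub_apply]
    push_cast
    ring)
  have h5 : ∑ β, charSign γ β * gradSquare (α + γ) β τ i j =
      2 * ∑ β, charSign γ β * (thetaGrad (α + γ) β τ i * thetaGrad (α + γ) β τ j) := by
    rw [Finset.mul_sum]
    refine Finset.sum_congr rfl fun β _ => ?_
    rw [gradSquare]; ring
  rw [h5, h4]
  split_ifs <;> field_simp <;> ring

/-! ### Determinant identities -/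

theorem det_of_sum_column {n ι R : Type*} [Fintype n] [DecidableEq n] [Fintype ι] [CommRing R]
    (s : n → ι → R) (C : n → ι → n → R) :
    ∑ β : n → ι, (∏ k, s k (β k)) * (Matrix.of fun r k => C k (β k) r).det
      = (Matrix.of fun r k => ∑ b, s k b * C k b r).det := by
  classical
  simp only [Matrix.det_apply', Matrix.of_apply, Finset.prod_univ_sum, Fintype.piFinset_univ,
    Finset.mul_sum]
  rw [Finset.sum_comm]
  refine Finset.sum_congr rfl fun σ _ => Finset.sum_congr rfl fun β _ => ?_
  rw [Finset.prod_mul_distrib]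
  ring

/-- Condensation of a determinant along its first row and column. -/
theorem pow_mul_det_succ {K : Type*} [Field K] {n : ℕ} (hn : 1 ≤ n)
    (M : Matrix (Fin (n + 1)) (Fin (n + 1)) K) :
    M 0 0 ^ (n - 1) * M.det =
      (Matrix.of fun r k : Fin n => M 0 0 * M r.succ k.succ - M 0 k.succ * M r.succ 0).det := by
  obtain ⟨n, rfl⟩ := Nat.exists_eq_add_of_le' hn
  rw [Nat.add_sub_cancel]
  by_cases hx : M 0 0 = 0
  · rcases n with _ | n
    · simp [Matrix.det_fin_two]
    · -- the condensed matrix has rank one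
      have : (Matrix.of fun r k : Fin (n + 2) => M 0 0 * M r.succ k.succ - M 0 k.succ * M r.succ 0)
          = Matrix.vecMulVec (fun r => M r.succ 0) (fun k => -M 0 k.succ) := by
        ext r k
        simp [hx, Matrix.vecMulVec_apply, mul_comm]
      rw [this, Matrix.det_vecMulVec, hx]
      simp
  · -- scale all columns but the first by `M 0 0`, then clear the first row
    have h1 := Matrix.det_mul_row (Fin.cons 1 fun _ => M 0 0 : Fin (n + 2) → K) M
    simp only [Fin.prod_univ_succ (n := n + 1), Fin.cons_zero, Fin.cons_succ, one_mul,
      Finset.prod_const, Finset.card_univ, Fintype.card_fin] at h1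
    set v : Fin (n + 2) → K := Fin.cons 1 fun _ => M 0 0 with hv
    set c : Fin (n + 2) → K := Fin.cons 0 fun k => -M 0 k.succ with hc
    have h2 : (Matrix.of fun i j => v j * M i j + c j * M i 0).det
        = (Matrix.of fun i j => v j * M i j).det := by
      rw [← Matrix.det_transpose, ← Matrix.det_transpose (Matrix.of fun i j => v j * M i j)]
      refine Matrix.det_eq_of_forall_row_eq_smul_add_const c 0 (by simp [hc]) fun i j => ?_
      simp [hv]
    rw [← h2, Matrix.det_succ_row_zero, Fin.sum_univ_succ, Finset.sum_eq_zero, add_zero] at h1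
    · apply mul_left_cancel₀ hx
      rw [← mul_assoc, ← pow_succ', ← h1]
      simp only [Fin.val_zero, pow_zero, one_mul, Matrix.of_apply, hv, hc, Fin.cons_zero, zero_mul,
        add_zero]
      congr 2
      ext r k
      simp [sub_eq_add_neg]
    · intro k _
      simp [hv, hc]
      left; ring

/-! ### Invariants of the special linear group -/

/-- The Levi-Civita symbol: the sign of `f` if `f` is a permutation, and `0` otherwise. -/
def leviCivita {n : Type*} [Fintype n] [DecidableEq n] (f : n → n) : ℤ :=
  (Matrix.of fun r k => (1 : Matrix n n ℤ) (f k) r).det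

theorem sum_leviCivita_mul_prod {n R : Type*} [Fintype n] [DecidableEq n] [CommRing R]
    (M : Matrix n n R) : ∑ f : n → n, (leviCivita f : R) * ∏ i, M i (f i) = M.det := by
  have h1 : ∀ f : n → n, (leviCivita f : R) =
      (Matrix.of fun r k => (1 : Matrix n n R) (f k) r).det := by
    intro f
    have := (Int.castRingHom R).map_det (Matrix.of fun r k => (1 : Matrix n n ℤ) (f k) r)
    rw [eq_intCast] at this
    rw [leviCivita, this]
    congr 1
    ext r k
    simp [Matrix.one_apply]
  have h2 := det_of_sum_column (fun i a => M i a) (fun _ a r => (1 : Matrix n n R) a r)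
  simp only [← h1] at h2
  rw [← M.det_transpose]
  convert! h2 using 1
  · exact Finset.sum_congr rfl fun f _ => mul_comm _ _
  · congr 1
    ext r k
    simp [Matrix.one_apply]

section Fischer

variable {n T : Type*} [Fintype n] [DecidableEq n] [Fintype T]

/-- A tuple `j` stands for the monomial `∏ₜ ∏ᵢ X_{i, j t i}` in the entries of an `n × n` matrix;
this is the coefficient of that tuple in the expansion of `det ^ |T|`. -/
def detPowCoeff (j : T → n → n) : ℤ := ∏ t, leviCivita (j t)

/-- The exponent vector of the monomial of a tuple. -/
noncomputable def tupleExponent (j : T → n → n) : n × n →₀ ℕ :=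
  ∑ t, ∑ i, Finsupp.single (i, j t i) 1

theorem tupleExponent_apply (j : T → n → n) (i a : n) :
    tupleExponent j (i, a) = Fintype.card {t // j t i = a} := by
  simp only [tupleExponent, Finsupp.coe_finsetSum, Finset.sum_apply, Finsupp.single_apply,
    Prod.mk.injEq, Fintype.card_subtype, Finset.card_filter]
  refine Finset.sum_congr rfl fun t _ => ?_
  rw [Finset.sum_eq_single i (fun b _ hb => by simp [hb]) (by simp)]
  simp

/-- Permuting the factors in each row of the monomial of a tuple. -/
def rowPerm (ρ : n → Equiv.Perm T) : (T → n → n) ≃ (T → n → n) where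
  toFun j t i := j (ρ i t) i
  invFun j t i := j ((ρ i)⁻¹ t) i
  left_inv j := by ext; simp
  right_inv j := by ext; simp

theorem exists_rowPerm_of_tupleExponent_eq {j j' : T → n → n}
    (h : tupleExponent j = tupleExponent j') : ∃ ρ, rowPerm ρ j' = j := by
  have h1 : ∀ i a, Nonempty ({t // j t i = a} ≃ {t // j' t i = a}) := fun i a =>
    Fintype.card_eq.1 (by rw [← tupleExponent_apply, ← tupleExponent_apply, h])
  refine ⟨fun i => Equiv.ofFiberEquiv (f := fun t => j t i) (g := fun t => j' t i)
    fun a => (h1 i a).some, ?_⟩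
  ext t i
  exact Equiv.ofFiberEquiv_map (f := fun t => j t i) (g := fun t => j' t i) _ t

variable [DecidableEq T]

theorem sum_detPowCoeff_mul_prod {R : Type*} [CommRing R] (A : Matrix n n R) :
    ∑ j : T → n → n, (detPowCoeff j : R) * ∏ t, ∏ i, A i (j t i) = A.det ^ Fintype.card T := by
  rw [← sum_leviCivita_mul_prod, ← Finset.card_univ, ← Finset.prod_const, Finset.prod_univ_sum,
    Fintype.piFinset_univ]
  refine Finset.sum_congr rfl fun j _ => ?_
  rw [Finset.prod_mul_distrib, detPowCoeff, Int.cast_prod]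

/-- The functional on tuples that represents the Fischer pairing with `det ^ |T|`: the sum of the
coefficients `detPowCoeff` over all ways to write the same monomial. -/
def fischerCoeff (j : T → n → n) : ℤ := ∑ ρ : n → Equiv.Perm T, detPowCoeff (rowPerm ρ j)

theorem fischerCoeff_rowPerm (ρ : n → Equiv.Perm T) (j : T → n → n) :
    fischerCoeff (rowPerm ρ j) = fischerCoeff j :=
  Fintype.sum_equiv (Equiv.mulLeft ρ) _ _ fun _ => rfl

/-- The Fischer norm of `det ^ |T|` is positive. -/
theorem sum_fischerCoeff_mul_detPowCoeff_ne_zero :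
    ∑ j : T → n → n, fischerCoeff j * detPowCoeff j ≠ 0 := by
  have h1 : ∑ j : T → n → n, fischerCoeff j ^ 2 =
      Fintype.card (n → Equiv.Perm T) * ∑ j : T → n → n, fischerCoeff j * detPowCoeff j := by
    have : ∀ ρ : n → Equiv.Perm T,
        ∑ j : T → n → n, fischerCoeff j * detPowCoeff (rowPerm ρ j) =
          ∑ j : T → n → n, fischerCoeff j * detPowCoeff j := fun ρ =>
      Fintype.sum_equiv (rowPerm ρ) _ _ fun j => by rw [fischerCoeff_rowPerm]
    simp only [sq]
    conv_lhs => enter [2, j, 2]; rw [fischerCoeff]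
    simp only [Finset.mul_sum]
    rw [Finset.sum_comm]
    simp [this, Finset.mul_sum]
  have h2 : 0 < ∑ j : T → n → n, fischerCoeff j ^ 2 := by
    refine Finset.sum_pos' (fun j _ => sq_nonneg _) ⟨fun _ i => i, Finset.mem_univ _, ?_⟩
    have h3 : leviCivita (fun i : n => i) = 1 := by
      rw [leviCivita, ← Matrix.det_one (n := n), ← Matrix.det_transpose]
      rfl
    have h4 : fischerCoeff (fun (_ : T) (i : n) => i) = Fintype.card (n → Equiv.Perm T) := by
      simp [fischerCoeff, detPowCoeff, rowPerm, h3]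
    rw [h4]
    have := Fintype.card_pos (α := n → Equiv.Perm T)
    positivity
  intro h
  rw [h1, h, mul_zero] at h2
  exact h2.false

/-- The Fischer pairing is well defined on polynomial functions of a matrix. -/
theorem sum_fischerCoeff_mul_eq_zero {K : Type*} [Field K] [Infinite K] (φ : (T → n → n) → K)
    (h : ∀ A : Matrix n n K, ∑ j, φ j * ∏ t, ∏ i, A i (j t i) = 0) :
    ∑ j, (fischerCoeff j : K) * φ j = 0 := by
  classical
  have hP : ∑ j, MvPolynomial.monomial (tupleExponent j) (φ j) = 0 := by
    refine MvPolynomial.funext fun A => ?_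
    rw [map_sum, map_zero, ← h fun i a => A (i, a)]
    refine Finset.sum_congr rfl fun j _ => ?_
    rw [MvPolynomial.eval_monomial, tupleExponent, ← Finsupp.prod_finsetSum_index (by simp)
      (by simp [pow_add])]
    congr 1
    refine Finset.prod_congr rfl fun t _ => ?_
    rw [← Finsupp.prod_finsetSum_index (by simp) (by simp [pow_add])]
    simp
  rw [← Finset.sum_fiberwise_of_maps_to (g := tupleExponent)
    (fun j _ => Finset.mem_image_of_mem _ (Finset.mem_univ j))]
  refine Finset.sum_eq_zero fun m hm => ?_
  obtain ⟨j₀, -, rfl⟩ := Finset.mem_image.1 hm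
  have hc := congrArg (MvPolynomial.coeff (tupleExponent j₀)) hP
  simp only [MvPolynomial.coeff_sum, MvPolynomial.coeff_monomial, MvPolynomial.coeff_zero,
    ← Finset.sum_filter] at hc
  rw [← mul_zero (fischerCoeff j₀ : K), ← hc, Finset.mul_sum]
  refine Finset.sum_congr rfl fun j hj => ?_
  obtain ⟨ρ, rfl⟩ := exists_rowPerm_of_tupleExponent_eq (Finset.mem_filter.1 hj).2
  rw [fischerCoeff_rowPerm]

/-- The first fundamental theorem for the special linear group, in explicit form: a polynomial `f`
in the entries of an `n × κ` matrix `V`, written as a sum of monomials which have degree `|T|` in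
each row, that satisfies `f (A V) = det A ^ |T| f V`, is up to a nonzero factor the
symmetrization of its monomials to products of `|T|` maximal minors of `V`. -/
theorem sum_fischerCoeff_mul_eq_sum_prod_det {K κ P : Type*} [Field K] [Infinite K] [Fintype P]
    (s : P → K) (k : P → T → n → κ)
    (hf : ∀ (A : Matrix n n K) (V : Matrix n κ K),
      ∑ p, s p * ∏ t, ∏ i, (A * V) i (k p t i) =
        A.det ^ Fintype.card T * ∑ p, s p * ∏ t, ∏ i, V i (k p t i)) (V : Matrix n κ K) :
    ((∑ j : T → n → n, fischerCoeff j * detPowCoeff j : ℤ) : K) *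
        ∑ p, s p * ∏ t, ∏ i, V i (k p t i) =
      ∑ ρ : n → Equiv.Perm T, ∑ p, s p * ∏ t, (V.submatrix id fun i => k p (ρ i t) i).det := by
  set f := ∑ p, s p * ∏ t, ∏ i, V i (k p t i) with hfdef
  have h1 : ∑ j : T → n → n, (fischerCoeff j : K) *
      (∑ p, s p * ∏ t, ∏ i, V (j t i) (k p t i) - f * detPowCoeff j) = 0 := by
    refine sum_fischerCoeff_mul_eq_zero _ fun A => ?_
    simp only [sub_mul, Finset.sum_sub_distrib, mul_assoc, ← Finset.mul_sum]
    rw [sum_detPowCoeff_mul_prod, mul_comm f, ← hf A V, sub_eq_zero]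
    simp only [Matrix.mul_apply, Finset.prod_univ_sum, Fintype.piFinset_univ, Finset.mul_sum,
      Finset.sum_mul]
    rw [Finset.sum_comm]
    refine Finset.sum_congr rfl fun p _ => Finset.sum_congr rfl fun j _ => ?_
    simp only [Finset.prod_mul_distrib]
    ring
  simp only [mul_sub, Finset.sum_sub_distrib, sub_eq_zero] at h1
  have h2 : ((∑ j : T → n → n, fischerCoeff j * detPowCoeff j : ℤ) : K) * f =
      ∑ j : T → n → n, (fischerCoeff j : K) * (f * detPowCoeff j) := by
    push_cast
    rw [Finset.sum_mul]
    exact Finset.sum_congr rfl fun j _ => by ring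
  rw [h2, ← h1]
  simp only [fischerCoeff, Int.cast_sum, Finset.sum_mul]
  rw [Finset.sum_comm]
  refine Finset.sum_congr rfl fun ρ _ => ?_
  simp only [Finset.mul_sum]
  rw [Finset.sum_comm]
  refine Finset.sum_congr rfl fun p _ => ?_
  have h3 : ∀ t, (V.submatrix id fun i => k p (ρ i t) i).det =
      ∑ f : n → n, (leviCivita f : K) * ∏ i, V (f i) (k p (ρ i t) i) := by
    intro t
    rw [← Matrix.det_transpose, ← sum_leviCivita_mul_prod]
    rfl
  simp only [h3, Finset.prod_univ_sum, Fintype.piFinset_univ, Finset.mul_sum]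
  refine Fintype.sum_equiv (rowPerm ρ) _ _ fun j => ?_
  rw [Finset.prod_mul_distrib, detPowCoeff, Int.cast_prod]
  have h4 : ∏ t, ∏ i, V (j t i) (k p t i) =
      ∏ t, ∏ i, V (rowPerm ρ j t i) (k p (ρ i t) i) := by
    rw [Finset.prod_comm, Finset.prod_comm (s := Finset.univ (α := T))]
    exact Finset.prod_congr rfl fun i _ =>
      (Equiv.prod_comp (ρ i) fun t => V (j t i) (k p t i)).symm
  rw [h4]
  ring

end Fischer

/-! ### The symmetric square -/

theorem symPair_le (g : ℕ) (r : Fin (symDim g)) : (symPair g r).1 ≤ (symPair g r).2 := by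
  have := (symPairs g).orderEmbOfFin_mem (card_symPairs g) r
  exact (Finset.mem_filter.1 this).2

theorem symPair_injective (g : ℕ) : Function.Injective (symPair g) := fun _ _ h =>
  ((symPairs g).orderEmbOfFin (card_symPairs g)).injective (ofLex.injective h)

theorem exists_symPair_eq {g : ℕ} {i j : Fin g} (h : i ≤ j) : ∃ r, symPair g r = (i, j) := by
  have hm : toLex (i, j) ∈ (symPairs g : Set (Fin g ×ₗ Fin g)) := by simpa [symPairs] using h
  rw [← (symPairs g).range_orderEmbOfFin (card_symPairs g)] at hm
  obtain ⟨r, hr⟩ := hm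
  exact ⟨r, by rw [symPair, hr, ofLex_toLex]⟩

/-- The pairs `i ≤ j` as a type. -/
noncomputable def symPairEquiv (g : ℕ) : Fin (symDim g) ≃ {p : Fin g × Fin g // p.1 ≤ p.2} :=
  Equiv.ofBijective (fun r => ⟨symPair g r, symPair_le g r⟩)
    ⟨fun r s h => by
      have h' : symPair g r = symPair g s :=
        congrArg (fun p : {p : Fin g × Fin g // p.1 ≤ p.2} => p.1) h
      exact symPair_injective g h', fun ⟨_, hp⟩ => by
      obtain ⟨r, hr⟩ := exists_symPair_eq hp
      exact ⟨r, Subtype.ext hr⟩⟩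

theorem sum_symPair {g : ℕ} {R : Type*} [AddCommMonoid R] (F : Fin g × Fin g → R) :
    ∑ r, F (symPair g r) = ∑ i, ∑ j, if i ≤ j then F (i, j) else 0 := by
  rw [← Fintype.sum_prod_type' (f := fun i j => if i ≤ j then F (i, j) else 0),
    ← Finset.sum_filter, Finset.sum_subtype (p := fun p : Fin g × Fin g => p.1 ≤ p.2) _ (by simp)]
  exact Fintype.sum_equiv (symPairEquiv g) _ _ fun _ => rfl

theorem card_symPair_diag (g : ℕ) :
    (Finset.univ.filter fun r => (symPair g r).1 = (symPair g r).2).card = g := by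
  rw [Finset.card_filter, sum_symPair fun p => if p.1 = p.2 then 1 else 0]
  have : ∀ i j : Fin g, (if i ≤ j then if i = j then 1 else 0 else 0) = if i = j then 1 else 0 := by
    intro i j
    split_ifs <;> grind
  simp [this]

/-- A slot `(r, 0)` or `(r, 1)` carries the first or the second index of the `r`-th pair. -/
def slotIndex (g : ℕ) (s : Fin (symDim g) × Fin 2) : Fin g :=
  if s.2 = 0 then (symPair g s.1).1 else (symPair g s.1).2

theorem card_slotIndex_fiber {g : ℕ} (i : Fin g) :
    Fintype.card {s // slotIndex g s = i} = g + 1 := by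
  rw [Fintype.card_subtype, Finset.card_filter, Fintype.sum_prod_type]
  simp only [Fin.sum_univ_two, slotIndex, if_true, Fin.isValue, one_ne_zero, if_false]
  rw [sum_symPair fun p => (if p.1 = i then 1 else 0) + if p.2 = i then 1 else 0]
  have h1 : ∀ a b : Fin g,
      (if a ≤ b then (if a = i then 1 else 0) + (if b = i then 1 else 0) else 0) =
        (if a = i then if i ≤ b then 1 else 0 else 0) +
        (if b = i then if a ≤ i then 1 else 0 else 0) := by
    intro a b
    split_ifs <;> grind
  simp only [h1, Finset.sum_add_distrib]
  rw [Finset.sum_comm (f := fun a b : Fin g => if b = i then if a ≤ i then 1 else 0 else 0)]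
  have h2 : ∀ (c : Fin g → ℕ), ∑ a, (∑ b, if a = i then c b else 0) = ∑ b, c b := by
    intro c
    rw [Finset.sum_comm]
    simp
  rw [h2, h2, ← Finset.card_filter, ← Finset.card_filter, Finset.filter_le_eq_Ici,
    Finset.filter_ge_eq_Iic, Fin.card_Ici, Fin.card_Iic]
  omega

/-- A numbering of the slots that carry a given index: each index has `g + 1` of them. -/
noncomputable def slotEquiv (g : ℕ) : Fin (symDim g) × Fin 2 ≃ Fin g × Fin (g + 1) :=
  Equiv.ofFiberEquiv (f := slotIndex g) (g := Prod.fst) fun i =>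
    Fintype.equivOfCardEq (by
      rw [card_slotIndex_fiber, Fintype.card_subtype, Finset.card_filter, Fintype.sum_prod_type,
        Finset.sum_comm]
      simp)

theorem slotEquiv_fst {g : ℕ} (s : Fin (symDim g) × Fin 2) :
    (slotEquiv g s).1 = slotIndex g s :=
  Equiv.ofFiberEquiv_map (f := slotIndex g) (g := Prod.fst) _ s

/-- Regrouping the `2 N` slots by the index that they carry turns a product over the pairs `i ≤ j`
into a product with exactly `g + 1` factors for each index. -/
theorem prod_symPair_mul {g : ℕ} {R : Type*} [CommMonoid R] (F : Fin g → Fin (symDim g) → R) :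
    ∏ r, F (symPair g r).1 r * F (symPair g r).2 r =
      ∏ t : Fin (g + 1), ∏ i, F i ((slotEquiv g).symm (i, t)).1 := by
  rw [Finset.prod_comm, ← Fintype.prod_prod_type'
    (f := fun i t => F i ((slotEquiv g).symm (i, t)).1)]
  rw [← Fintype.prod_equiv (slotEquiv g) (fun s => F (slotIndex g s) s.1) _ fun s => by
    rw [Prod.mk.eta, Equiv.symm_apply_apply, slotEquiv_fst]]
  rw [Fintype.prod_prod_type]
  simp [Fin.prod_univ_two, slotIndex]

/-- The symmetric matrix with given entries at the places `(i, j)`, `i ≤ j`. -/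
def symOfVec (g : ℕ) : (Fin (symDim g) → ℂ) →ₗ[ℂ] Matrix (Fin g) (Fin g) ℂ :=
  ∑ r, (LinearMap.proj r : (Fin (symDim g) → ℂ) →ₗ[ℂ] ℂ).smulRight
    (symUnit (symPair g r).1 (symPair g r).2)

/-- The entries of a matrix at the places `(i, j)`, `i ≤ j`. -/
def vecOfMatrix (g : ℕ) : Matrix (Fin g) (Fin g) ℂ →ₗ[ℂ] (Fin (symDim g) → ℂ) where
  toFun S r := S (symPair g r).1 (symPair g r).2
  map_add' _ _ := rfl
  map_smul' _ _ := rfl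

theorem symOfVec_apply {g : ℕ} (x : Fin (symDim g) → ℂ) (a b : Fin g) :
    symOfVec g x a b = ∑ r, x r * symUnit (symPair g r).1 (symPair g r).2 a b := by
  simp [symOfVec, Matrix.sum_apply]

theorem symUnit_symPair_of_le {g : ℕ} (r : Fin (symDim g)) {a b : Fin g} (h : a ≤ b) :
    symUnit (symPair g r).1 (symPair g r).2 a b = if symPair g r = (a, b) then 1 else 0 := by
  have := symPair_le g r
  have h2 : ((a = (symPair g r).1 ∧ b = (symPair g r).2) ∨
      (a = (symPair g r).2 ∧ b = (symPair g r).1)) ↔ symPair g r = (a, b) := by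
    rw [Prod.ext_iff]
    constructor
    · rintro (h | h) <;> constructor <;> simp only <;> omega
    · rintro ⟨h1, h2⟩
      exact Or.inl ⟨h1.symm, h2.symm⟩
  simp only [symUnit, h2]

theorem symOfVec_symPair {g : ℕ} (x : Fin (symDim g) → ℂ) (r : Fin (symDim g)) :
    symOfVec g x (symPair g r).1 (symPair g r).2 = x r := by
  simp [symOfVec_apply, symUnit_symPair_of_le _ (symPair_le g r), (symPair_injective g).eq_iff]

theorem vecOfMatrix_symOfVec {g : ℕ} (x : Fin (symDim g) → ℂ) :
    vecOfMatrix g (symOfVec g x) = x := by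
  ext r
  exact symOfVec_symPair x r

theorem isSymm_symOfVec {g : ℕ} (x : Fin (symDim g) → ℂ) : (symOfVec g x).IsSymm := by
  ext a b
  simp only [Matrix.transpose_apply, symOfVec_apply]
  refine Finset.sum_congr rfl fun r _ => ?_
  congr 1
  unfold symUnit
  grind

theorem symOfVec_vecOfMatrix {g : ℕ} {S : Matrix (Fin g) (Fin g) ℂ} (hS : S.IsSymm) :
    symOfVec g (vecOfMatrix g S) = S := by
  have h : ∀ a b : Fin g, a ≤ b → symOfVec g (vecOfMatrix g S) a b = S a b := by
    intro a b hab
    obtain ⟨r, hr⟩ := exists_symPair_eq hab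
    have := symOfVec_symPair (vecOfMatrix g S) r
    rw [hr] at this
    rw [this]
    change S (symPair g r).1 (symPair g r).2 = S a b
    rw [hr]
  ext a b
  rcases le_total a b with hab | hab
  · exact h a b hab
  · rw [← (isSymm_symOfVec _).apply, ← hS.apply, h b a hab]

theorem Matrix.IsSymm.conj {n R : Type*} [Fintype n] [CommRing R] {S : Matrix n n R}
    (hS : S.IsSymm) (A : Matrix n n R) : (A * S * A.transpose).IsSymm := by
  simp [Matrix.IsSymm, Matrix.transpose_mul, hS.eq, Matrix.mul_assoc]

/-- The symmetric square of a matrix: `S ↦ A S ᵗA` in the coordinates `S_ij`, `i ≤ j`, of a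
symmetric matrix `S`. -/
def symSquare (g : ℕ) : Matrix (Fin g) (Fin g) ℂ →* Module.End ℂ (Fin (symDim g) → ℂ) where
  toFun A :=
    { toFun := fun x => vecOfMatrix g (A * symOfVec g x * A.transpose)
      map_add' := fun x y => by simp [Matrix.mul_add, Matrix.add_mul]
      map_smul' := fun c x => by simp }
  map_one' := by
    refine LinearMap.ext fun x => ?_
    simp [vecOfMatrix_symOfVec]
  map_mul' A B := by
    refine LinearMap.ext fun x => ?_
    simp only [LinearMap.coe_mk, AddHom.coe_mk, Module.End.mul_apply]
    rw [symOfVec_vecOfMatrix ((isSymm_symOfVec x).conj B)]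
    simp [Matrix.mul_assoc]

theorem symSquare_apply {g : ℕ} (A : Matrix (Fin g) (Fin g) ℂ) (x : Fin (symDim g) → ℂ) :
    symSquare g A x = vecOfMatrix g (A * symOfVec g x * A.transpose) := rfl

/-- A multiplicative function on matrices is trivial on a transvection `T(c)`, because `T(c)` is
conjugate to `T(2c) = T(c)²`. -/
theorem map_transvection_eq_one {n K : Type*} [Fintype n] [DecidableEq n] [Field K] [CharZero K]
    (χ : Matrix n n K →* K) {i j : n} (hij : i ≠ j) (c : K) :
    χ (Matrix.transvection i j c) = 1 := by
  set D : n → K := fun a => if a = i then 2 else 1 with hD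
  have h0 : ∀ a, D a ≠ 0 := by
    intro a
    simp only [hD]
    split_ifs <;> norm_num
  have h1 : Matrix.diagonal D * Matrix.transvection i j c =
      Matrix.transvection i j (c + c) * Matrix.diagonal D := by
    have hj : D j = 1 := by simp [hD, hij.symm]
    have hi : D i = 2 := by simp [hD]
    ext a b
    simp only [Matrix.diagonal_mul, Matrix.mul_diagonal, Matrix.transvection, Matrix.add_apply,
      Matrix.one_apply, Matrix.single_apply]
    by_cases ha : i = a <;> by_cases hb : j = b
    · subst ha hb; simp [hij, hi, hj]; ring
    · simp only [hb, and_false, if_false]; split_ifs with h <;> simp [h]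
    · simp only [ha, false_and, if_false]; split_ifs with h <;> simp [h]
    · simp only [hb, and_false, if_false]; split_ifs with h <;> simp [h]
  have h2 : χ (Matrix.diagonal D) ≠ 0 := by
    intro h
    have : χ (Matrix.diagonal D * Matrix.diagonal fun a => (D a)⁻¹) = 1 := by
      rw [Matrix.diagonal_mul_diagonal]
      simp [h0]
    rw [map_mul, h, zero_mul] at this
    exact zero_ne_one this
  have h3 : χ (Matrix.transvection i j c) ≠ 0 := by
    intro h
    have : χ (Matrix.transvection i j c * Matrix.transvection i j (-c)) = 1 := by
      rw [Matrix.transvection_mul_transvection_same _ _ hij]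
      simp
    rw [map_mul, h, zero_mul] at this
    exact zero_ne_one this
  have h4 := congrArg χ h1
  rw [← Matrix.transvection_mul_transvection_same _ _ hij, map_mul, map_mul, map_mul,
    mul_comm] at h4
  exact (mul_left_cancel₀ h3 ((mul_one _).trans (mul_right_cancel₀ h2 h4))).symm

theorem det_symSquare {g : ℕ} (A : Matrix (Fin g) (Fin g) ℂ) :
    LinearMap.det (symSquare g A) = A.det ^ (g + 1) := by
  set χ : Matrix (Fin g) (Fin g) ℂ →* ℂ := LinearMap.det.comp (symSquare g)
  change χ A = _
  induction A using Matrix.diagonal_transvection_induction with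
  | hdiag D _ =>
    have h1 : LinearMap.toMatrix' (symSquare g (Matrix.diagonal D)) =
        Matrix.diagonal fun r => D (symPair g r).1 * D (symPair g r).2 := by
      have : symSquare g (Matrix.diagonal D) = Matrix.toLin'
          (Matrix.diagonal fun r => D (symPair g r).1 * D (symPair g r).2) := by
        refine LinearMap.ext fun x => ?_
        ext r
        rw [symSquare_apply, Matrix.toLin'_apply, Matrix.mulVec_diagonal, Matrix.diagonal_transpose]
        change (Matrix.diagonal D * symOfVec g x * Matrix.diagonal D) _ _ = _
        rw [Matrix.mul_diagonal, Matrix.diagonal_mul, symOfVec_symPair]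
        ring
      rw [this, LinearMap.toMatrix'_toLin']
    change LinearMap.det (symSquare g (Matrix.diagonal D)) = _
    rw [← LinearMap.det_toMatrix', h1, Matrix.det_diagonal, Matrix.det_diagonal,
      prod_symPair_mul fun i _ => D i]
    simp
  | htransvec t =>
    obtain ⟨i, j, hij, c⟩ := t
    rw [Matrix.TransvectionStruct.toMatrix_mk, map_transvection_eq_one χ hij,
      Matrix.det_transvection_of_ne _ _ hij, one_pow]
  | hmul A B hA hB => rw [map_mul, hA, hB, Matrix.det_mul, mul_pow]

/-- The determinant whose vanishing says that the columns of `V`, as points of projective space,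
lie on a quadric: its columns are the symmetric squares of the columns of `V`. -/
def quadricDet {g : ℕ} (V : Matrix (Fin g) (Fin (symDim g)) ℂ) : ℂ :=
  (Matrix.of fun r k => V (symPair g r).1 k * V (symPair g r).2 k).det

/-- `quadricDet` is a relative invariant of the general linear group. -/
theorem quadricDet_mul {g : ℕ} (A : Matrix (Fin g) (Fin g) ℂ)
    (V : Matrix (Fin g) (Fin (symDim g)) ℂ) :
    quadricDet (A * V) = A.det ^ (g + 1) * quadricDet V := by
  rw [← det_symSquare, ← LinearMap.det_toMatrix', quadricDet, quadricDet, ← Matrix.det_mul]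
  congr 1
  ext r k
  set v : Fin g → ℂ := fun i => V i k
  have h1 : ∀ x, (LinearMap.toMatrix' (symSquare g A)).mulVec x = symSquare g A x := fun x => by
    rw [← Matrix.toLin'_apply, Matrix.toLin'_toMatrix']
  have hs : (Matrix.vecMulVec v v).IsSymm := by
    ext a b; simp [Matrix.vecMulVec_apply, mul_comm]
  have h2 := congrFun (h1 (vecOfMatrix g (Matrix.vecMulVec v v))) r
  rw [symSquare_apply, symOfVec_vecOfMatrix hs, Matrix.mul_vecMulVec, Matrix.vecMulVec_mul,
    Matrix.vecMul_transpose] at h2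
  exact h2.symm

/-- `quadricDet` is a homogeneous polynomial of degree `g + 1` in the maximal minors. -/
theorem exists_homogeneous_quadricDet (g : ℕ) :
    ∃ Q : MvPolynomial (Fin g → Fin (symDim g)) ℂ, Q.IsHomogeneous (g + 1) ∧
      ∀ V : Matrix (Fin g) (Fin (symDim g)) ℂ,
        quadricDet V = MvPolynomial.eval (fun c => (V.submatrix id c).det) Q := by
  let k : Equiv.Perm (Fin (symDim g)) → Fin (g + 1) → Fin g → Fin (symDim g) :=
    fun σ t i => σ ((slotEquiv g).symm (i, t)).1
  let s : Equiv.Perm (Fin (symDim g)) → ℂ := fun σ => ((Equiv.Perm.sign σ : ℤ) : ℂ)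
  have hexp : ∀ V : Matrix (Fin g) (Fin (symDim g)) ℂ,
      quadricDet V = ∑ σ, s σ * ∏ t, ∏ i, V i (k σ t i) := by
    intro V
    rw [quadricDet, ← Matrix.det_transpose, Matrix.det_apply']
    refine Finset.sum_congr rfl fun σ _ => ?_
    congr 1
    exact prod_symPair_mul fun i r => V i (σ r)
  have key := sum_fischerCoeff_mul_eq_sum_prod_det s k fun A V => by
    rw [← hexp, ← hexp, quadricDet_mul, Fintype.card_fin]
  set C : ℂ := ((∑ j : Fin (g + 1) → Fin g → Fin g, fischerCoeff j * detPowCoeff j : ℤ) : ℂ)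
  have hC : C ≠ 0 := Int.cast_ne_zero.2 sum_fischerCoeff_mul_detPowCoeff_ne_zero
  refine ⟨MvPolynomial.C C⁻¹ * ∑ ρ : Fin g → Equiv.Perm (Fin (g + 1)), ∑ σ,
    MvPolynomial.C (s σ) * ∏ t, MvPolynomial.X fun i => k σ (ρ i t) i, ?_, fun V => ?_⟩
  · refine MvPolynomial.IsHomogeneous.C_mul (MvPolynomial.IsHomogeneous.sum _ _ _ fun ρ _ =>
      MvPolynomial.IsHomogeneous.sum _ _ _ fun σ _ => MvPolynomial.IsHomogeneous.C_mul ?_ _) _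
    have := MvPolynomial.IsHomogeneous.prod (R := ℂ) Finset.univ
      (fun t : Fin (g + 1) => MvPolynomial.X fun i => k σ (ρ i t) i) (fun _ => 1)
      fun t _ => MvPolynomial.isHomogeneous_X ℂ _
    simpa using this
  · have h := key V
    rw [← hexp] at h
    simp only [map_mul, MvPolynomial.eval_C, map_sum, map_prod, MvPolynomial.eval_X]
    rw [← h, inv_mul_cancel_left₀ hC]

/-! ### Jacobian determinants of theta functions -/

theorem det_gradSquareVec_eq {g : ℕ} (ε δ : Fin (symDim g) → HalfChar g)
    (τ : Matrix (Fin g) (Fin g) ℂ) :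
    (Matrix.of fun r k => gradSquareVec (ε k) (δ k) τ r).det =
      2 ^ symDim g * quadricDet (Matrix.of fun i k => thetaGrad (ε k) (δ k) τ i) := by
  have h := Matrix.det_smul (Matrix.of fun r k =>
    thetaGrad (ε k) (δ k) τ (symPair g r).1 * thetaGrad (ε k) (δ k) τ (symPair g r).2) (2 : ℂ)
  rw [Fintype.card_fin] at h
  rw [quadricDet]
  simp only [Matrix.of_apply]
  rw [← h]
  congr 1
  ext r k
  simp [gradSquareVec, gradSquare, mul_assoc]

theorem exists_homogeneous_det_gradSquareVec {g : ℕ}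
    (ε δ : Fin (symDim g) → HalfChar g) :
    ∃ P : MvPolynomial (Fin g → OddChar g) ℂ, P.IsHomogeneous (g + 1) ∧
      ∀ τ ∈ SiegelUpperHalfSpace g,
        (Matrix.of fun r k => gradSquareVec (ε k) (δ k) τ r).det =
          MvPolynomial.eval (fun c => jacobianDet c τ) P := by
  have hp : (Real.pi : ℂ) ≠ 0 := by exact_mod_cast Real.pi_ne_zero
  -- an even characteristic gives a zero column, so that the zero polynomial serves
  by_cases hodd : ∀ k, ε k ⬝ᵥ δ k = 1
  · obtain ⟨Q, hQ, hQV⟩ := exists_homogeneous_quadricDet g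
    let o : Fin (symDim g) → OddChar g := fun k => ⟨(ε k, δ k), hodd k⟩
    refine ⟨MvPolynomial.C (2 ^ symDim g) *
      MvPolynomial.aeval (fun c => MvPolynomial.C ((Real.pi : ℂ) ^ g) * MvPolynomial.X (o ∘ c)) Q,
      MvPolynomial.IsHomogeneous.C_mul ?_ _, fun τ _ => ?_⟩
    · have := hQ.aeval (fun c => MvPolynomial.C ((Real.pi : ℂ) ^ g) * MvPolynomial.X (o ∘ c))
        (n := 1) fun c => MvPolynomial.IsHomogeneous.C_mul (MvPolynomial.isHomogeneous_X ℂ _) _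
      rwa [one_mul] at this
    rw [det_gradSquareVec_eq, hQV, map_mul, MvPolynomial.eval_C, MvPolynomial.map_aeval]
    congr 1
    have h1 : (fun c : Fin g → Fin (symDim g) =>
        ((Matrix.of fun i k => thetaGrad (ε k) (δ k) τ i).submatrix id c).det) =
        fun c => (Real.pi : ℂ) ^ g * jacobianDet (o ∘ c) τ := by
      ext c
      rw [jacobianDet, mul_inv_cancel_left₀ (pow_ne_zero _ hp)]
      rfl
    rw [h1]
    have h2 : (MvPolynomial.eval fun c : Fin g → OddChar g => jacobianDet c τ).comp
        (algebraMap ℂ (MvPolynomial (Fin g → OddChar g) ℂ)) = RingHom.id ℂ := by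
      ext x
      simp
    rw [h2]
    simp only [map_mul, MvPolynomial.eval_C, MvPolynomial.eval_X]
    rfl
  · push Not at hodd
    obtain ⟨k, hk⟩ := hodd
    refine ⟨0, MvPolynomial.isHomogeneous_zero _ _ _, fun τ hτ => ?_⟩
    rw [map_zero]
    refine Matrix.det_eq_zero_of_column_eq_zero k fun r => ?_
    simp [gradSquareVec, gradSquare, thetaGrad_eq_zero_of_ne_one hτ hk]

theorem mainTheorem4 (g : ℕ) (hg : 1 ≤ g) (ε : Fin (symDim g + 1) → HalfChar g) :
    (∀ τ ∈ SiegelUpperHalfSpace g,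
      ((2 : ℂ) ^ ((g + 1) * symDim g + g) * ((Real.pi : ℂ) * Complex.I) ^ symDim g) *
          secondThetaConst (ε 0) τ ^ (symDim g - 1) * (thetaMatrix ε τ).det
        = signedDetSum ε τ) ∧
    ∃ P : MvPolynomial (Fin g → OddChar g) ℂ, P.IsHomogeneous (g + 1) ∧
      ∀ τ ∈ SiegelUpperHalfSpace g,
        signedDetSum ε τ = MvPolynomial.eval (fun c => jacobianDet c τ) P := by
  refine ⟨fun τ hτ => ?_, ?_⟩
  · have hN : 1 ≤ symDim g := (Nat.one_le_div_iff two_pos).2 (by nlinarith)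
    have hM := pow_mul_det_succ hN (thetaMatrix ε τ)
    have h00 : thetaMatrix ε τ 0 0 = secondThetaConst (ε 0) τ := rfl
    rw [h00] at hM
    rw [mul_assoc, hM, signedDetSum, det_of_sum_column (fun k b => charSign (ε k.succ) b)
      (fun k b r => gradSquareVec (ε 0 + ε k.succ) b τ r)]
    simp only [gradSquareVec, sum_charSign_mul_gradSquare hτ]
    -- the `g` diagonal pairs contribute an additional factor `2` each
    have hκ : ∏ r, (2 : ℂ) ^ (g + 2) * (Real.pi * Complex.I) /
        (if (symPair g r).1 = (symPair g r).2 then 1 else 2) =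
        2 ^ ((g + 1) * symDim g + g) * (Real.pi * Complex.I) ^ symDim g := by
      have h1 : ∀ r, (2 : ℂ) ^ (g + 2) * (Real.pi * Complex.I) /
          (if (symPair g r).1 = (symPair g r).2 then 1 else 2) =
          2 ^ (g + 1) * (Real.pi * Complex.I) *
            if (symPair g r).1 = (symPair g r).2 then 2 else 1 := by
        intro r
        split_ifs <;> ring
      rw [Finset.prod_congr rfl fun r _ => h1 r, Finset.prod_mul_distrib, Finset.prod_ite,
        Finset.prod_const_one, Finset.prod_const, Finset.prod_const, card_symPair_diag,
        Finset.card_univ, Fintype.card_fin]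
      ring
    rw [← hκ, ← Matrix.det_mul_column]
    rfl
  · choose P hP hPτ using fun β : Fin (symDim g) → HalfChar g =>
      exists_homogeneous_det_gradSquareVec (fun k => ε 0 + ε k.succ) β
    refine ⟨∑ β, MvPolynomial.C (∏ k, charSign (ε k.succ) (β k)) * P β,
      MvPolynomial.IsHomogeneous.sum _ _ _ fun β _ => MvPolynomial.IsHomogeneous.C_mul (hP β) _,
      fun τ hτ => ?_⟩
    rw [signedDetSum, map_sum]
    refine Finset.sum_congr rfl fun β _ => ?_
    rw [map_mul, MvPolynomial.eval_C, hPτ β τ hτ]
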